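/- Let $\Gamma$ be a graph with finite vertex set $X$ in which each edge $\{s,t\}$ is labelled by an integer $m_{s,t}=m_{t,s}\ge 2$, and let $A_\Gamma=\langle X\mid \underbrace{sts\cdots}_{m_{s,t}}=\underbrace{tst\cdots}_{m_{s,t}}\text{ for every edge }\{s,t\}\rangle$ be the associated Artin group. Let $M\subset A_\Gamma$ be its positive monoid, i.e. the submonoid generated by $X$. For $T\subset X$, let $A_T\le A_\Gamma$ be the subgroup generated by $T$ and let $M_T\subset A_T$ be its positive monoid, i.e. the submonoid generated by $T$. The monoid Cayley graph $\mathrm{Cay}(A_\Gamma,M)$ has vertex set $A_\Gamma$ and an edge joining $g$ to $gm$, oriented from $g$ to $gm$, for all $g\in A_\Gamma$ and $m\in M$; paths may follow edges in either direction. The graph $\mathrm{Cay}(A_T,M_T)$ is defined in the same way. Proposition. For every nonempty $T\subset X$ there is a simplicial retraction $r$ of $\mathrm{Cay}(A_\Gamma,M)$ onto $\mathrm{Cay}(A_T,M_T)$, that is, a map $r\colon A_\Gamma\to A_T$ with $r(a)=a$ for all $a\in A_T$ that sends each edge of $\mathrm{Cay}(A_\Gamma,M)$ either to a single vertex or to a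 single edge of $\mathrm{Cay}(A_T,M_T)$. Moreover $r$ can be chosen to respect orientations and labels: for all $g\in A_\Gamma$ and $m\in M$ there is $m'\in M_T$ with $r(gm)=r(g)m'$. Hence the natural inclusion of $\mathrm{Cay}(A_T,M_T)$ into $\mathrm{Cay}(A_\Gamma,M)$ is an isometric embedding: it preserves the path distance between any two vertices, and it maps geodesics to geodesics. -/

import Mathlib

/-! Artin groups. The labelled defining graph `Γ` on the vertex set `X` is encoded by a Coxeter
matrix: for `s ≠ t`, the entry `Γ s t ≥ 2` is the label of the edge `{s, t}`, and `Γ s t = 0`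
(standing for `m = ∞`) means that there is no edge between `s` and `t`. -/

/-- The alternating word `s t s t ⋯` with `n` letters, starting with `s`. -/
def altWord {X : Type*} (s t : X) : ℕ → List X
  | 0 => []
  | n + 1 => s :: altWord t s n

/-- The relator `(s t s ⋯)(t s t ⋯)⁻¹`, both words having `Γ s t` letters. It is trivial if
`Γ s t = 0` (no edge) or if `s = t`. -/
def artinRelator {X : Type*} (Γ : CoxeterMatrix X) (s t : X) : FreeGroup X :=
  ((altWord s t (Γ s t)).map FreeGroup.of).prod *
    ((altWord t s (Γ s t)).map FreeGroup.of).prod⁻¹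

/-- The Artin group `A_Γ`. -/
abbrev ArtinGroup {X : Type*} (Γ : CoxeterMatrix X) : Type _ :=
  PresentedGroup (Set.range (Function.uncurry (artinRelator Γ)))

namespace ArtinGroup

variable {X : Type*} (Γ : CoxeterMatrix X)

/-- The standard generator of `A_Γ` attached to `s`. -/
def gen (s : X) : ArtinGroup Γ := PresentedGroup.of s

/-- The positive monoid `M` of `A_Γ`: the elements represented by positive words in the standard
generators. -/
def positiveMonoid : Submonoid (ArtinGroup Γ) :=
  Submonoid.closure (Set.range (gen Γ))

/-- The special subgroup `A_T` of `A_Γ` generated by `T`. -/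
def specialSubgroup (T : Set X) : Subgroup (ArtinGroup Γ) :=
  Subgroup.closure (gen Γ '' T)

/-- The positive monoid `M_T` of `A_T`: the elements of `A_T` represented by positive words in the
generators from `T`. -/
def specialPositiveMonoid (T : Set X) : Submonoid (specialSubgroup Γ T) :=
  Submonoid.closure {a | ∃ t ∈ T, (a : ArtinGroup Γ) = gen Γ t}

/-- The monoid Cayley graph `Cay(A_Γ, M)`; loops (the edges labelled `1`) are not recorded. -/
def monoidCayley : SimpleGraph (ArtinGroup Γ) :=
  SimpleGraph.mulCayley (positiveMonoid Γ : Set (ArtinGroup Γ))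

/-- The monoid Cayley graph `Cay(A_T, M_T)`; loops (the edges labelled `1`) are not recorded. -/
def specialMonoidCayley (T : Set X) : SimpleGraph (specialSubgroup Γ T) :=
  SimpleGraph.mulCayley (specialPositiveMonoid Γ T : Set (specialSubgroup Γ T))

theorem specialPositiveMonoid_le (T : Set X) {a : specialSubgroup Γ T}
    (ha : a ∈ specialPositiveMonoid Γ T) : (a : ArtinGroup Γ) ∈ positiveMonoid Γ := by
  have h : specialPositiveMonoid Γ T ≤
      (positiveMonoid Γ).comap (specialSubgroup Γ T).subtype := by
    refine Submonoid.closure_le.2 ?_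
    rintro b ⟨t, -, hb⟩
    exact Submonoid.subset_closure ⟨t, hb.symm⟩
  exact h ha

/-- The natural inclusion of `Cay(A_T, M_T)` into `Cay(A_Γ, M)`. -/
def cayleyInclusion (T : Set X) : specialMonoidCayley Γ T →g monoidCayley Γ where
  toFun a := (a : ArtinGroup Γ)
  map_rel' := by
    intro a b hab
    rw [specialMonoidCayley, SimpleGraph.mulCayley_adj] at hab
    rw [monoidCayley, SimpleGraph.mulCayley_adj]
    exact ⟨fun h => hab.1 (Subtype.ext h),
      hab.2.imp (fun h => specialPositiveMonoid_le Γ T h)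
        (fun h => specialPositiveMonoid_le Γ T h)⟩

/-- The Artin monoid `A_Γ⁺`: the monoid with the presentation that defines `A_Γ`. -/
abbrev ArtinMonoid : Type _ :=
  PresentedMonoid (fun v w : FreeMonoid X => ∃ s t : X,
    v = FreeMonoid.ofList (altWord s t (Γ s t)) ∧ w = FreeMonoid.ofList (altWord t s (Γ s t)))

theorem braid_relation (s t : X) :
    ((altWord s t (Γ s t)).map (gen Γ)).prod = ((altWord t s (Γ s t)).map (gen Γ)).prod := by
  have key : ∀ l : List X, PresentedGroup.mk (Set.range (Function.uncurry (artinRelator Γ)))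
      ((l.map FreeGroup.of).prod) = (l.map (gen Γ)).prod := by
    intro l
    rw [map_list_prod, List.map_map]
    rfl
  have h : PresentedGroup.mk (Set.range (Function.uncurry (artinRelator Γ)))
      (artinRelator Γ s t) = 1 :=
    PresentedGroup.one_of_mem ⟨(s, t), rfl⟩
  rw [artinRelator, map_mul, map_inv, key, key] at h
  exact mul_inv_eq_one.1 h

/-- The natural map from the Artin monoid to the Artin group. -/
def ofArtinMonoid : ArtinMonoid Γ →* ArtinGroup Γ :=
  PresentedMonoid.lift (gen Γ) (by
    rintro v w ⟨s, t, rfl, rfl⟩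
    simpa [FreeMonoid.lift_apply] using braid_relation Γ s t)

/-- The positive monoid is the image of the Artin monoid in the Artin group. -/
theorem mrange_ofArtinMonoid : MonoidHom.mrange (ofArtinMonoid Γ) = positiveMonoid Γ := by
  rw [MonoidHom.mrange_eq_map, ← PresentedMonoid.closure_range_of, MonoidHom.map_mclosure,
    ← Set.range_comp]
  rfl

end ArtinGroup

/-- A vertex map `r` is a simplicial retraction of the graph `G` onto `H`, which is mapped to `G`
by `i`, if it sends each edge of `G` to a vertex or to an edge of `H` and restricts to the
identity on `H`. -/
structure IsSimplicialRetraction {V W : Type*} {G : SimpleGraph V} {H : SimpleGraph W}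
    (i : H →g G) (r : V → W) : Prop where
  map_edge : ∀ u v : V, G.Adj u v → r u = r v ∨ H.Adj (r u) (r v)
  retract : ∀ w : W, r (i w) = w

/-- A walk is a geodesic if its length is the distance between its endpoints. -/
def SimpleGraph.Walk.IsGeodesic {V : Type*} {G : SimpleGraph V} {u v : V} (p : G.Walk u v) :
    Prop :=
  (p.length : ℕ∞) = G.edist u v

/-! Let W be the Coxeter group of Γ and W_T its subgroup generated by T. Represent right cosets W_T
w by elements w without left inversions in T. A generator i acts on the right on A_T × (W_T \ W): if
w s_i w⁻¹ = s_t with t ∈ T, it fixes the coset and multiplies the A_T-coordinate by t; otherwise it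
moves w to w s_i and leaves the A_T-coordinate alone. Once the braid relations are verified, A_Γ
acts, and r(g) is the A_T-coordinate of (1, W_T) · g. Positive generators contribute only positive
labels or 1, and A_T acts on the base coset by right multiplication, so r is a simplicial
retraction. Neither r nor the inclusion increases distances, hence the isometry.

The crux is `run_braid`. Let u be minimal in w W_{i,j}. If u conjugates both s_i and s_j to simple
reflections from T, then w = u and the relation becomes a braid relation of A_T. Otherwise at most
one t ∈ T has w⁻¹ s_t w in W_{i,j}. Each side of the relation then emits t at most once, exactly
when w⁻¹ s_t w is one of its inversions, and both sides have the same inversions.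

The Coxeter input is a mod 2 inversion cocycle, and the fact that s_i s_j has order exactly Γ i j,
read off from the geometric representation. -/

namespace CoxeterMatrix

/-! ### The geometric representation and orders of products of two reflections -/

open Polynomial.Chebyshev

variable {B : Type*} (M : CoxeterMatrix B)

/-- The simple coroots of the geometric representation, as linear forms on `B →₀ ℝ`. -/
noncomputable def coroot (i : B) : Module.Dual ℝ (B →₀ ℝ) :=
  Finsupp.linearCombination ℝ fun j => -2 * Real.cos (Real.pi / M i j)

theorem coroot_single (i j : B) :
    M.coroot i (Finsupp.single j 1) = -2 * Real.cos (Real.pi / M i j) := by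
  simp [coroot]

theorem coroot_single_self (i : B) : M.coroot i (Finsupp.single i 1) = 2 := by
  simp [coroot_single]

/-- The simple reflections of the geometric representation. -/
noncomputable def geomReflection (i : B) : (B →₀ ℝ) ≃ₗ[ℝ] (B →₀ ℝ) :=
  Module.reflection (M.coroot_single_self i)

theorem geomReflection_mul_self (i : B) : M.geomReflection i * M.geomReflection i = 1 :=
  LinearEquiv.ext (Module.involutive_reflection (M.coroot_single_self i))

/-- This is the trace of the product of the two reflections on their plane, a rotation by 2π/m.
Powers of the product are Chebyshev polynomials S evaluated at this number. -/
theorem coroot_mul_coroot_sub_two (i j : B) :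
    M.coroot i (Finsupp.single j 1) * M.coroot j (Finsupp.single i 1) - 2 =
      2 * Real.cos (2 * Real.pi / M i j) := by
  rw [coroot_single, coroot_single, M.symmetric j i, mul_div_assoc 2, Real.cos_two_mul]
  ring

theorem sin_two_pi_div_ne_zero {m : ℕ} (hm : 3 ≤ m) : Real.sin (2 * Real.pi / m) ≠ 0 := by
  have hm' : (3 : ℝ) ≤ m := by exact_mod_cast hm
  have hpi := Real.pi_pos
  refine (Real.sin_pos_of_pos_of_lt_pi (by positivity) ?_).ne'
  rw [div_lt_iff₀ (by positivity)]
  nlinarith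

theorem isLiftable_geomReflection : M.IsLiftable M.geomReflection := by
  intro i j
  rcases eq_or_ne i j with rfl | hij
  · rw [M.diagonal, pow_one]
    exact M.geomReflection_mul_self i
  rcases Nat.lt_or_ge (M i j) 3 with h | h
  · have h1 := M.off_diagonal i j hij
    have : M i j = 0 ∨ M i j = 2 := by omega
    rcases this with h0 | h2
    · rw [h0, pow_zero]
    · have hi : M.coroot i (Finsupp.single j 1) = 0 := by simp [coroot_single, h2]
      have hj : M.coroot j (Finsupp.single i 1) = 0 := by
        simp [coroot_single, M.symmetric j i, h2]
      refine LinearEquiv.ext fun x => ?_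
      simp only [geomReflection, h2, pow_two, LinearEquiv.mul_apply, Module.reflection_apply,
        map_sub, map_smul, hi, hj, coroot_single_self]
      change _ = x
      module
  · refine LinearEquiv.ext fun x => ?_
    have key := Module.reflection_mul_reflection_pow_apply (M.coroot_single_self i)
      (M.coroot_single_self j) (M i j) x _ (M.coroot_mul_coroot_sub_two i j).symm
    have hs := sin_two_pi_div_ne_zero h
    have hm0 : (M i j : ℝ) ≠ 0 := by positivity
    have hS (n : ℤ) := S_two_mul_real_cos (2 * Real.pi / M i j) n
    rw [geomReflection, geomReflection, key]
    rcases Nat.even_or_odd' (M i j) with ⟨k, hk | hk⟩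
    · have e1 : ((M i j : ℤ) - 2) / 2 = k - 1 := by omega
      have e2 : ((M i j : ℤ) - 1) / 2 = k - 1 := by omega
      -- With θ = 2π/m and m = 2k, S_{k-1}(2 cos θ) sin θ = sin kθ = sin π.
      have : (S ℝ ((k : ℤ) - 1)).eval (2 * Real.cos (2 * Real.pi / M i j)) = 0 := by
        refine (mul_eq_zero.1 ((hS _).trans ?_)).resolve_right hs
        rw [← Real.sin_pi]
        congr 1
        have : (M i j : ℝ) = 2 * k := by exact_mod_cast hk
        push_cast
        rw [this] at hm0 ⊢
        have hk0 : (k : ℝ) ≠ 0 := right_ne_zero_of_mul hm0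
        field_simp
        ring
      rw [e1, e2, this]
      simp
    · have e1 : ((M i j : ℤ) - 2) / 2 = k - 1 := by omega
      have e2 : ((M i j : ℤ) - 1) / 2 = k := by omega
      have e3 : ((M i j : ℤ) - 3) / 2 = k - 1 := by omega
      have e4 : (M i j : ℤ) / 2 = k := by omega
      -- With m = 2k + 1, the angles kθ and (k + 1)θ add up to 2π, so their sines cancel.
      have : (S ℝ (k : ℤ)).eval (2 * Real.cos (2 * Real.pi / M i j)) +
          (S ℝ ((k : ℤ) - 1)).eval (2 * Real.cos (2 * Real.pi / M i j)) = 0 := by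
        refine (mul_eq_zero.1 ?_).resolve_right hs
        rw [add_mul, hS, hS]
        have h1 : (((k : ℤ) : ℝ) + 1) * (2 * Real.pi / M i j) =
            2 * Real.pi - (((k : ℤ) - 1 : ℤ) + 1) * (2 * Real.pi / M i j) := by
          have : (M i j : ℝ) = 2 * k + 1 := by exact_mod_cast hk
          push_cast
          rw [this] at hm0 ⊢
          field_simp
          ring
        rw [h1, Real.sin_two_pi_sub]
        ring
      rw [e1, e2, e3, e4, this]
      simp

/-- The n-th power sends e_i to (S_n + S_{n-1}) e_i + 2 cos(π/m) S_{n-1} e_j. Comparing with e_i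
gives, for m ≥ 3, S_{n-1} = 0 and S_n = 1, whence cos(2πn/m) = 1. -/
theorem dvd_of_geomReflection_pow_eq_one {i j : B} (hij : i ≠ j) {n : ℕ}
    (h : (M.geomReflection i * M.geomReflection j) ^ n = 1) : M i j ∣ n := by
  have key := Module.reflection_mul_reflection_pow_apply_self (M.coroot_single_self i)
      (M.coroot_single_self j) n _ (M.coroot_mul_coroot_sub_two i j).symm
  change ((M.geomReflection i * M.geomReflection j) ^ n) _ = _ at key
  rw [h, LinearEquiv.coe_one, id] at key
  have k1 := DFunLike.congr_fun key i
  have k2 := DFunLike.congr_fun key j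
  have h1 := M.off_diagonal i j hij
  simp only [Finsupp.coe_add, Finsupp.coe_smul, Pi.add_apply, Pi.smul_apply,
    Finsupp.single_eq_same, Finsupp.single_eq_of_ne hij, Finsupp.single_eq_of_ne hij.symm,
    smul_eq_mul, mul_one, mul_zero, add_zero, zero_add, coroot_single, M.symmetric j i] at k1 k2
  rcases Nat.lt_or_ge (M i j) 3 with h3 | h3
  · have : M i j = 0 ∨ M i j = 2 := by omega
    rcases this with h0 | h2
    -- For the label ∞, encoded as 0, the convention π / 0 = 0 gives the correct cosine 1. The
    -- product is then unipotent and the e_j-coefficient is 2n.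
    · simp only [h0, Nat.cast_zero, div_zero, Real.cos_zero, mul_one, S_eval_two] at k2
      have : (n : ℝ) = 0 := by push_cast at k2; linarith
      simp [Nat.cast_eq_zero.1 this]
    · simp only [h2] at k1
      rw [show 2 * Real.pi / (2 : ℕ) = Real.pi by push_cast; ring, Real.cos_pi, mul_neg_one,
        S_eval_neg_two, S_eval_neg_two] at k1
      rw [h2]
      by_contra hn
      have hn' : Odd (n : ℤ) := by
        rw [← even_iff_two_dvd, Nat.not_even_iff_odd] at hn
        exact_mod_cast hn
      have hn'' : Even ((n : ℤ) - 1) := hn'.sub_odd odd_one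
      rw [Int.negOnePow_odd _ hn', Int.negOnePow_even _ hn''] at k1
      push_cast at k1
      linarith
  · have hs := sin_two_pi_div_ne_zero h3
    have hpi := Real.pi_pos
    have hm3 : (3 : ℝ) ≤ M i j := by exact_mod_cast h3
    have hc : Real.cos (Real.pi / M i j) ≠ 0 := by
      refine (Real.cos_pos_of_mem_Ioo ⟨?_, ?_⟩).ne'
      · have : 0 < Real.pi / M i j := by positivity
        linarith
      · rw [div_lt_div_iff₀ (by positivity) (by positivity)]
        nlinarith
    have hS (n : ℤ) := S_two_mul_real_cos (2 * Real.pi / M i j) n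
    have z : (S ℝ ((n : ℤ) - 1)).eval (2 * Real.cos (2 * Real.pi / M i j)) = 0 := by
      refine (mul_eq_zero.1 k2.symm).resolve_right ?_
      simpa using hc
    have z1 := hS ((n : ℤ) - 1)
    rw [z, zero_mul] at z1
    rw [z, add_zero] at k1
    have z2 := hS n
    rw [← k1, one_mul, add_mul, one_mul, Real.sin_add] at z2
    push_cast at z1 z2
    rw [sub_add_cancel] at z1
    rw [← z1, zero_mul, zero_add] at z2
    have hcos : Real.cos (n * (2 * Real.pi / M i j)) = 1 := by
      have := mul_right_cancel₀ hs ((one_mul _).trans z2)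
      exact this.symm
    obtain ⟨q, hq⟩ := (Real.cos_eq_one_iff _).1 hcos
    have hq' : (n : ℝ) = q * M i j := by
      field_simp at hq
      linarith
    have : (n : ℤ) = q * M i j := by exact_mod_cast hq'
    exact Int.natCast_dvd_natCast.1 ⟨q, by rw [this, mul_comm]⟩

end CoxeterMatrix

/-! ### Exact orders in a Coxeter group, and alternating words -/

namespace CoxeterSystem

variable {B W : Type*} [Group W] {M : CoxeterMatrix B} (cs : CoxeterSystem M W)

theorem orderOf_simple_mul_simple (i j : B) : orderOf (cs.simple i * cs.simple j) = M i j := by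
  rcases eq_or_ne i j with rfl | hij
  · simp
  refine Nat.dvd_antisymm (orderOf_dvd_of_pow_eq_one (cs.simple_mul_simple_pow i j)) ?_
  refine M.dvd_of_geomReflection_pow_eq_one hij ?_
  have := congrArg (cs.lift ⟨_, M.isLiftable_geomReflection⟩)
    (pow_orderOf_eq_one (cs.simple i * cs.simple j))
  simpa only [map_pow, map_mul, lift_apply_simple, map_one] using this

theorem simple_injective : Function.Injective cs.simple := by
  intro i j h
  by_contra hij
  refine M.off_diagonal i j hij ?_
  rw [← cs.orderOf_simple_mul_simple, h, simple_mul_simple_self, orderOf_one]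

end CoxeterSystem

theorem map_altWord_two_mul_prod {X G : Type*} [Monoid G] (g : X → G) (s t : X) (n : ℕ) :
    ((altWord s t (2 * n)).map g).prod = (g s * g t) ^ n := by
  induction n with
  | zero => simp [altWord]
  | succ n ih =>
    rw [mul_add, mul_one, altWord, altWord, List.map_cons, List.map_cons, List.prod_cons,
      List.prod_cons, ih, pow_succ', mul_assoc]

theorem mem_altWord {X : Type*} {s t x : X} {n : ℕ} (h : x ∈ altWord s t n) :
    x = s ∨ x = t := by
  induction n generalizing s t with
  | zero => simp [altWord] at h
  | succ n ih =>
    rw [altWord, List.mem_cons] at h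
    exact h.elim Or.inl fun h => (ih h).symm

theorem reverse_alternatingWord {X : Type*} (s t : X) (n : ℕ) :
    (CoxeterSystem.alternatingWord s t n).reverse = altWord t s n := by
  induction n generalizing s t with
  | zero => rfl
  | succ n ih => rw [CoxeterSystem.alternatingWord, List.concat_eq_append, List.reverse_append, ih]; rfl

/-! ### Inversion sequences and the inversion cocycle -/

namespace CoxeterSystem

variable {B W : Type*} [Group W] {M : CoxeterMatrix B} (cs : CoxeterSystem M W)

theorem wordProd_altWord_comm (i j : B) :
    cs.wordProd (altWord i j (M i j)) = cs.wordProd (altWord j i (M i j)) := by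
  rw [← reverse_alternatingWord, ← reverse_alternatingWord, wordProd_reverse, wordProd_reverse]
  have h := cs.wordProd_braidWord_eq j i
  rw [braidWord, braidWord, M.symmetric j i] at h
  rw [h]

theorem leftInvSeq_altWord (i j : B) (n : ℕ) :
    cs.leftInvSeq (altWord i j n) =
      (List.range n).map fun p => (cs.simple i * cs.simple j) ^ p * cs.simple i := by
  induction n generalizing i j with
  | zero => rfl
  | succ n ih =>
    rw [altWord, leftInvSeq, ih, List.range_succ_eq_map, List.map_cons, List.map_map, List.map_map,
      pow_zero, one_mul]
    congr 1
    refine List.map_congr_left fun p _ => ?_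
    have h : ∀ q : ℕ, cs.simple i * (cs.simple j * cs.simple i) ^ q =
        (cs.simple i * cs.simple j) ^ q * cs.simple i := by
      intro q
      induction q with
      | zero => simp
      | succ q ih => rw [pow_succ, ← mul_assoc, ih, pow_succ]; simp only [mul_assoc]
    simp only [Function.comp_apply, MulAut.conj_apply, inv_simple, Nat.succ_eq_add_one]
    rw [← mul_assoc, h, pow_succ]
    simp only [mul_assoc]

/-- The entries are (s_i s_j)^p s_i with p < M i j, and M i j is the exact order of s_i s_j. -/
theorem nodup_leftInvSeq_altWord (i j : B) : (cs.leftInvSeq (altWord i j (M i j))).Nodup := by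
  rw [leftInvSeq_altWord]
  refine List.Nodup.map_on ?_ List.nodup_range
  intro p hp q hq h
  rw [List.mem_range, ← cs.orderOf_simple_mul_simple] at hp hq
  exact pow_injOn_Iio_orderOf hp hq (mul_right_cancel h)

open Classical in
/-- The action of a simple reflection on functions on `W` underlying the inversion cocycle. -/
noncomputable def inversionStep (i : B) : Function.End (W → ZMod 2) := fun f r =>
  (if r = cs.simple i then 1 else 0) + f (cs.simple i * r * cs.simple i)

open Classical in
theorem map_inversionStep_prod (ω : List B) (f : W → ZMod 2) (r : W) :
    (ω.map cs.inversionStep).prod f r =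
      ((cs.leftInvSeq ω).count r : ZMod 2) + f ((cs.wordProd ω)⁻¹ * r * cs.wordProd ω) := by
  induction ω generalizing r with
  | nil => simp; rfl
  | cons i ω ih =>
    have h1 : List.count r ((cs.leftInvSeq ω).map (MulAut.conj (cs.simple i))) =
        List.count (cs.simple i * r * cs.simple i) (cs.leftInvSeq ω) := by
      rw [← List.count_map_of_injective (cs.leftInvSeq ω) (MulAut.conj (cs.simple i))
        (MulEquiv.injective _) (cs.simple i * r * cs.simple i)]
      congr 1
      simp [mul_assoc]
    rw [List.map_cons, List.prod_cons]
    change cs.inversionStep i ((ω.map cs.inversionStep).prod f) r = _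
    rw [inversionStep, ih, leftInvSeq, List.count_cons, h1, wordProd_cons]
    simp only [beq_iff_eq, eq_comm (a := cs.simple i), Nat.cast_add, Nat.cast_ite, Nat.cast_one,
      Nat.cast_zero, mul_inv_rev, inv_simple, mul_assoc]
    ring

open Classical in
theorem isLiftable_inversionStep : M.IsLiftable cs.inversionStep := by
  intro i j
  rw [← map_altWord_two_mul_prod]
  funext f r
  have hπ : cs.wordProd (altWord i j (2 * M i j)) = 1 := by
    rw [wordProd, map_altWord_two_mul_prod, simple_mul_simple_pow]
  have hr : ∀ p : ℕ, (cs.simple i * cs.simple j) ^ (M i j + p) = (cs.simple i * cs.simple j) ^ p := by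
    intro p
    rw [pow_add, simple_mul_simple_pow, one_mul]
  rw [map_inversionStep_prod, hπ, leftInvSeq_altWord, two_mul, List.range_add, List.map_append,
    List.map_map, List.count_append]
  -- The entries at positions p and M i j + p agree, so every element is counted an even number of
  -- times.
  simp only [Function.comp_def, hr, Nat.cast_add, CharTwo.add_self_eq_zero, zero_add]
  simp
  rfl

/-- The inversion cocycle: `cs.inversionParity w r` is the parity of the number of occurrences of
`r` in the left inversion sequence of any word for `w`. -/
noncomputable def inversionParity (w : W) : W → ZMod 2 :=
  cs.lift ⟨_, cs.isLiftable_inversionStep⟩ w 0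

open Classical in
theorem lift_inversionStep_wordProd (ω : List B) (f : W → ZMod 2) (r : W) :
    cs.lift ⟨_, cs.isLiftable_inversionStep⟩ (cs.wordProd ω) f r =
      ((cs.leftInvSeq ω).count r : ZMod 2) + f ((cs.wordProd ω)⁻¹ * r * cs.wordProd ω) := by
  have h : ω.map (cs.lift ⟨_, cs.isLiftable_inversionStep⟩ ∘ cs.simple) =
      ω.map cs.inversionStep :=
    List.map_congr_left fun i _ => cs.lift_apply_simple cs.isLiftable_inversionStep i
  rw [← map_inversionStep_prod, wordProd, map_list_prod, List.map_map, h]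

open Classical in
theorem inversionParity_wordProd (ω : List B) (r : W) :
    cs.inversionParity (cs.wordProd ω) r = ((cs.leftInvSeq ω).count r : ZMod 2) := by
  rw [inversionParity, lift_inversionStep_wordProd, Pi.zero_apply, add_zero]

theorem inversionParity_mul (u v r : W) :
    cs.inversionParity (u * v) r = cs.inversionParity u r + cs.inversionParity v (u⁻¹ * r * u) := by
  obtain ⟨ω, rfl⟩ := cs.wordProd_surjective u
  rw [inversionParity_wordProd, inversionParity, map_mul]
  exact cs.lift_inversionStep_wordProd ω _ r

@[simp]
theorem inversionParity_one (r : W) : cs.inversionParity 1 r = 0 := by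
  simpa using cs.inversionParity_wordProd [] r

open Classical in
theorem inversionParity_simple (i : B) (r : W) :
    cs.inversionParity (cs.simple i) r = if r = cs.simple i then 1 else 0 := by
  have := cs.inversionParity_wordProd [i] r
  simpa [List.count_singleton, eq_comm (a := r)] using this

theorem mem_leftInvSeq_of_inversionParity_ne_zero {ω : List B} {r : W}
    (h : cs.inversionParity (cs.wordProd ω) r ≠ 0) : r ∈ cs.leftInvSeq ω := by
  classical
  by_contra hr
  exact h (by rw [inversionParity_wordProd, List.count_eq_zero.2 hr, Nat.cast_zero])

/-- Without repetition the multiplicity is 0 or 1 and its parity decides membership. So the set of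
inversions depends only on the group element. -/
theorem mem_leftInvSeq_iff_of_nodup {ω : List B} (hω : (cs.leftInvSeq ω).Nodup) (r : W) :
    r ∈ cs.leftInvSeq ω ↔ cs.inversionParity (cs.wordProd ω) r = 1 := by
  classical
  rw [inversionParity_wordProd, hω.count]
  split_ifs with h <;> simp [h]

theorem length_mul_lt_of_inversionParity_ne_zero {w r : W} (h : cs.inversionParity w r ≠ 0) :
    cs.length (r * w) < cs.length w := by
  obtain ⟨ω, hω, rfl⟩ := cs.exists_isReduced w
  exact (cs.isLeftInversion_of_mem_leftInvSeq hω
    (cs.mem_leftInvSeq_of_inversionParity_ne_zero h)).2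

/-! ### Parabolic subgroups and minimal coset representatives -/

theorem exists_word_of_mem_closure {J : Set B} {d : W}
    (hd : d ∈ Subgroup.closure (cs.simple '' J)) :
    ∃ ω : List B, (∀ i ∈ ω, i ∈ J) ∧ cs.wordProd ω = d := by
  induction hd using Subgroup.closure_induction with
  | mem x hx =>
    obtain ⟨i, hi, rfl⟩ := hx
    exact ⟨[i], by simpa using hi, by simp⟩
  | one => exact ⟨[], by simp, by simp⟩
  | mul x y _ _ hx hy =>
    obtain ⟨ω, h1, rfl⟩ := hx
    obtain ⟨ω', h2, rfl⟩ := hy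
    refine ⟨ω ++ ω', fun i hi => ?_, cs.wordProd_append _ _⟩
    exact (List.mem_append.1 hi).elim (h1 i) (h2 i)
  | inv x _ hx =>
    obtain ⟨ω, h1, rfl⟩ := hx
    exact ⟨ω.reverse, fun i hi => h1 i (List.mem_reverse.1 hi), cs.wordProd_reverse _⟩

theorem mem_closure_of_mem_leftInvSeq {J : Set B} {ω : List B} (h : ∀ i ∈ ω, i ∈ J) {r : W}
    (hr : r ∈ cs.leftInvSeq ω) : r ∈ Subgroup.closure (cs.simple '' J) := by
  induction ω generalizing r with
  | nil => simp at hr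
  | cons i ω ih =>
    have hi : cs.simple i ∈ Subgroup.closure (cs.simple '' J) :=
      Subgroup.subset_closure ⟨i, h i (by simp), rfl⟩
    rw [leftInvSeq, List.mem_cons, List.mem_map] at hr
    rcases hr with rfl | ⟨r', hr', rfl⟩
    · exact hi
    · rw [MulAut.conj_apply]
      exact mul_mem (mul_mem hi (ih (fun j hj => h j (List.mem_cons_of_mem _ hj)) hr')) (inv_mem hi)

/-- Exchange argument inside J: the first letter of a J-word for d is not an inversion of d, so it
must be an inversion of the remaining word. It therefore cancels against a later letter, leaving a
shorter J-word for d. -/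
theorem eq_one_of_inversionParity_simple_eq_zero {J : Set B} {d : W}
    (hd : d ∈ Subgroup.closure (cs.simple '' J))
    (h : ∀ i ∈ J, cs.inversionParity d (cs.simple i) = 0) : d = 1 := by
  obtain ⟨ω, hω, rfl⟩ := cs.exists_word_of_mem_closure hd
  generalize hn : ω.length = n
  induction n using Nat.strong_induction_on generalizing ω with
  | _ n ih =>
    rcases ω with _ | ⟨i, ω⟩
    · simp
    have hi := h i (hω i (by simp))
    rw [wordProd_cons, inversionParity_mul, inversionParity_simple, if_pos rfl] at hi
    have hi' : cs.inversionParity (cs.wordProd ω) (cs.simple i) ≠ 0 := by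
      intro h0
      simp [h0] at hi
    obtain ⟨p, hp, hpe⟩ := List.mem_iff_getElem.1 (cs.mem_leftInvSeq_of_inversionParity_ne_zero hi')
    have key := cs.getD_leftInvSeq_mul_wordProd ω p
    rw [List.getD_eq_getElem _ 1 hp, hpe, ← wordProd_cons] at key
    rw [cs.length_leftInvSeq] at hp
    rw [key] at hd h ⊢
    refine ih (ω.eraseIdx p).length ?_ _
      (fun j hj => hω j (List.mem_cons_of_mem _ (List.mem_of_mem_eraseIdx hj))) hd h rfl
    have := List.length_eraseIdx_add_one hp
    rw [List.length_cons] at hn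
    omega

/-- A shortest u in w D works for any subgroup D: an inversion of the form u d u⁻¹ would make u d,
which is in the same coset, shorter. -/
theorem exists_minimal_coset_rep (D : Subgroup W) (w : W) :
    ∃ u, u⁻¹ * w ∈ D ∧ ∀ d ∈ D, cs.inversionParity u (u * d * u⁻¹) = 0 := by
  obtain ⟨c, hc⟩ : ∃ c : D, ∀ d : D, cs.length (w * c) ≤ cs.length (w * d) :=
    ⟨_, fun d => Function.argmin_le (fun d : D => cs.length (w * d)) d⟩
  refine ⟨w * c, by simp, fun d hd => ?_⟩
  by_contra h
  have h1 := cs.length_mul_lt_of_inversionParity_ne_zero h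
  have h2 := hc (c * ⟨d, hd⟩)
  rw [inv_mul_cancel_right, mul_assoc] at h1
  exact h1.not_ge h2

/-- A simple reflection that preserves a minimal coset `u W_J` acts on it as an element of `J`. -/
theorem exists_simple_eq_conj {J : Set B} {u : W} {k : B}
    (hu : ∀ d ∈ Subgroup.closure (cs.simple '' J), cs.inversionParity u (u * d * u⁻¹) = 0)
    (hk : u⁻¹ * cs.simple k * u ∈ Subgroup.closure (cs.simple '' J)) :
    ∃ i ∈ J, cs.simple k = u * cs.simple i * u⁻¹ := by
  by_contra! hne
  -- Put d = u⁻¹ s_k u and expand the cocycle of u d = s_k u at u s_i u⁻¹ in both ways. Minimality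
  -- of u kills every term except the value of d at s_i, so d has no inversion in J.
  have h1 : u⁻¹ * cs.simple k * u = 1 := by
    refine cs.eq_one_of_inversionParity_simple_eq_zero hk fun i hi => ?_
    have hi' : cs.simple i ∈ Subgroup.closure (cs.simple '' J) :=
      Subgroup.subset_closure ⟨i, hi, rfl⟩
    have e1 := cs.inversionParity_mul u (u⁻¹ * cs.simple k * u) (u * cs.simple i * u⁻¹)
    have e2 := cs.inversionParity_mul (cs.simple k) u (u * cs.simple i * u⁻¹)
    have e3 := hu _ (mul_mem (mul_mem hk hi') (inv_mem hk))
    rw [inversionParity_simple, if_neg (hne i hi).symm, zero_add] at e2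
    simp only [mul_assoc, mul_inv_rev, inv_inv, inv_simple, inv_mul_cancel_left, mul_inv_cancel_left,
      inv_mul_cancel, mul_inv_cancel, mul_one] at e1 e2 e3
    have e4 := hu _ hi'
    rw [mul_assoc] at e4
    rw [e2, e3, e4, zero_add] at e1
    simpa only [mul_assoc] using e1.symm
  have h2 : cs.simple k = 1 := by
    rw [mul_assoc, inv_mul_eq_one] at h1
    exact mul_eq_right.1 h1.symm
  simpa [h2] using cs.length_simple k

theorem eq_minimal_coset_rep {J : Set B} {u w : W}
    (hu : ∀ d ∈ Subgroup.closure (cs.simple '' J), cs.inversionParity u (u * d * u⁻¹) = 0)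
    (hw : u⁻¹ * w ∈ Subgroup.closure (cs.simple '' J))
    (h : ∀ i ∈ J, cs.inversionParity w (u * cs.simple i * u⁻¹) = 0) : w = u := by
  refine (inv_mul_eq_one.1 (cs.eq_one_of_inversionParity_simple_eq_zero hw fun i hi => ?_)).symm
  have e1 := cs.inversionParity_mul u (u⁻¹ * w) (u * cs.simple i * u⁻¹)
  rw [mul_inv_cancel_left, h i hi, hu _ (Subgroup.subset_closure ⟨i, hi, rfl⟩), zero_add] at e1
  simpa only [mul_assoc, inv_mul_cancel_left, inv_mul_cancel, mul_one] using e1.symm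

end CoxeterSystem

theorem map_altWord {X Y : Type*} (f : X → Y) (s t : X) (n : ℕ) :
    (altWord s t n).map f = altWord (f s) (f t) n := by
  induction n generalizing s t with
  | zero => rfl
  | succ n ih => rw [altWord, List.map_cons, ih]; rfl

/-! ### The action of a single generator on A_T × (W_T \ W) -/

namespace ArtinGroup

variable {X : Type*} (Γ : CoxeterMatrix X) (T : Set X)

/-- The minimal representatives `w` of the cosets `W_T w` in the Coxeter group `W`: those which
have no left inversion in `T`. -/
abbrev MinimalRep : Type _ :=
  {w : Γ.Group // ∀ t ∈ T, Γ.toCoxeterSystem.inversionParity w (Γ.toCoxeterSystem.simple t) = 0}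

/-- The right coset `W_T w` is fixed by the generator `i`. -/
def IsFixed (i : X) (w : Γ.Group) : Prop :=
  ∃ t ∈ T, Γ.toCoxeterSystem.simple t = w * Γ.toCoxeterSystem.simple i * w⁻¹

theorem not_isFixed_mul {i : X} {w : Γ.Group} (h : ¬ IsFixed Γ T i w) :
    ¬ IsFixed Γ T i (w * Γ.toCoxeterSystem.simple i) := by
  rintro ⟨t, ht, e⟩
  exact h ⟨t, ht, by simpa [mul_assoc] using e⟩

/-- The standard generator of `A_T` attached to `t ∈ T`. -/
def specialGen (t : T) : specialSubgroup Γ T :=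
  ⟨gen Γ t, Subgroup.subset_closure ⟨t, t.2, rfl⟩⟩

theorem specialGen_mem (t : T) : specialGen Γ T t ∈ specialPositiveMonoid Γ T :=
  Submonoid.subset_closure ⟨t, t.2, rfl⟩

theorem specialGen_braid (s t : T) :
    ((altWord s t (Γ s t)).map (specialGen Γ T)).prod =
      ((altWord t s (Γ s t)).map (specialGen Γ T)).prod := by
  apply Subtype.ext
  have h : ∀ l : List T, (((l.map (specialGen Γ T)).prod : specialSubgroup Γ T) : ArtinGroup Γ) =
      ((l.map Subtype.val).map (gen Γ)).prod := by
    intro l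
    rw [Subgroup.val_list_prod, List.map_map, List.map_map]
    rfl
  rw [h, h, map_altWord Subtype.val, map_altWord Subtype.val, braid_relation]

open Classical in
/-- The action of the generator `i` on minimal representatives. -/
noncomputable def repStep (i : X) (w : MinimalRep Γ T) : MinimalRep Γ T :=
  if h : IsFixed Γ T i w.1 then w else
    ⟨w.1 * Γ.toCoxeterSystem.simple i, fun t ht => by
      rw [CoxeterSystem.inversionParity_mul, w.2 t ht, zero_add,
        CoxeterSystem.inversionParity_simple, if_neg]
      intro e
      exact h ⟨t, ht, by rw [← e]; simp [mul_assoc]⟩⟩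

open Classical in
/-- The label in `A_T` of the step from `w` along the generator `i`. -/
noncomputable def stepLabel (i : X) (w : MinimalRep Γ T) : specialSubgroup Γ T :=
  if h : IsFixed Γ T i w.1 then specialGen Γ T ⟨h.choose, h.choose_spec.1⟩ else 1

theorem stepLabel_mem (i : X) (w : MinimalRep Γ T) :
    stepLabel Γ T i w ∈ specialPositiveMonoid Γ T := by
  rw [stepLabel]
  split_ifs with h
  · exact specialGen_mem Γ T _
  · exact one_mem _

theorem repStep_of_isFixed {i : X} {w : MinimalRep Γ T} (h : IsFixed Γ T i w.1) :
    repStep Γ T i w = w := dif_pos h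

theorem repStep_of_not_isFixed {i : X} {w : MinimalRep Γ T} (h : ¬ IsFixed Γ T i w.1) :
    (repStep Γ T i w).1 = w.1 * Γ.toCoxeterSystem.simple i := by
  rw [repStep, dif_neg h]

theorem stepLabel_of_eq {i : X} {w : MinimalRep Γ T} (t : T)
    (ht : Γ.toCoxeterSystem.simple (t : X) = w.1 * Γ.toCoxeterSystem.simple i * w.1⁻¹) :
    stepLabel Γ T i w = specialGen Γ T t := by
  have h : IsFixed Γ T i w.1 := ⟨t, t.2, ht⟩
  rw [stepLabel, dif_pos h]
  congr 1
  exact Subtype.ext (Γ.toCoxeterSystem.simple_injective (h.choose_spec.2.trans ht.symm))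

theorem stepLabel_of_not_isFixed {i : X} {w : MinimalRep Γ T} (h : ¬ IsFixed Γ T i w.1) :
    stepLabel Γ T i w = 1 := dif_neg h

theorem repStep_repStep (i : X) (w : MinimalRep Γ T) : repStep Γ T i (repStep Γ T i w) = w := by
  by_cases h : IsFixed Γ T i w.1
  · rw [repStep_of_isFixed Γ T h, repStep_of_isFixed Γ T h]
  · have h1 := repStep_of_not_isFixed Γ T h
    apply Subtype.ext
    rw [repStep_of_not_isFixed, h1, CoxeterSystem.simple_mul_simple_cancel_right]
    rw [h1]
    exact not_isFixed_mul Γ T h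

/-- The permutation of `A_T × (W_T \ W)` given by the generator `i`. -/
noncomputable def stepPerm (i : X) : Equiv.Perm (specialSubgroup Γ T × MinimalRep Γ T) where
  toFun p := (p.1 * stepLabel Γ T i p.2, repStep Γ T i p.2)
  invFun p := (p.1 * (stepLabel Γ T i (repStep Γ T i p.2))⁻¹, repStep Γ T i p.2)
  left_inv p := by simp [repStep_repStep]
  right_inv p := by simp [repStep_repStep]

theorem stepPerm_apply (i : X) (p : specialSubgroup Γ T × MinimalRep Γ T) :
    stepPerm Γ T i p = (p.1 * stepLabel Γ T i p.2, repStep Γ T i p.2) := rfl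

/-- The action of a positive word, from left to right. -/
noncomputable def run (l : List X) (p : specialSubgroup Γ T × MinimalRep Γ T) :
    specialSubgroup Γ T × MinimalRep Γ T :=
  l.foldl (fun p i => stepPerm Γ T i p) p

theorem run_cons (i : X) (l : List X) (p : specialSubgroup Γ T × MinimalRep Γ T) :
    run Γ T (i :: l) p = run Γ T l (stepPerm Γ T i p) := rfl

theorem run_of_forall_notMem (l : List X) (p : specialSubgroup Γ T × MinimalRep Γ T)
    (h : ∀ t ∈ T, p.2.1⁻¹ * Γ.toCoxeterSystem.simple t * p.2.1 ∉ Γ.toCoxeterSystem.leftInvSeq l) :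
    (run Γ T l p).1 = p.1 ∧ (run Γ T l p).2.1 = p.2.1 * Γ.toCoxeterSystem.wordProd l := by
  induction l generalizing p with
  | nil => simp [run]
  | cons i l ih =>
    have hi : ¬ IsFixed Γ T i p.2.1 := by
      rintro ⟨t, ht, e⟩
      refine h t ht ?_
      rw [e, CoxeterSystem.leftInvSeq]
      simp [-CoxeterMatrix.toCoxeterSystem_simple, mul_assoc]
    have h1 := repStep_of_not_isFixed Γ T hi
    have h2 := stepLabel_of_not_isFixed Γ T hi
    obtain ⟨e1, e2⟩ := ih (stepPerm Γ T i p) (by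
      intro t ht hm
      refine h t ht ?_
      rw [CoxeterSystem.leftInvSeq, List.mem_cons, List.mem_map]
      refine Or.inr ⟨_, hm, ?_⟩
      rw [stepPerm_apply, h1]
      simp [-CoxeterMatrix.toCoxeterSystem_simple, mul_assoc])
    rw [run_cons, e1, e2, stepPerm_apply, h1, h2, CoxeterSystem.wordProd_cons, mul_one, mul_assoc]
    exact ⟨rfl, rfl⟩

theorem run_of_mem {J : Set X} (l : List X) (hl : ∀ i ∈ l, i ∈ J)
    (hnd : (Γ.toCoxeterSystem.leftInvSeq l).Nodup)
    (p : specialSubgroup Γ T × MinimalRep Γ T) (t : T)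
    (ht : p.2.1⁻¹ * Γ.toCoxeterSystem.simple (t : X) * p.2.1 ∈ Γ.toCoxeterSystem.leftInvSeq l)
    (huniq : ∀ t' ∈ T, p.2.1⁻¹ * Γ.toCoxeterSystem.simple t' * p.2.1 ∈
      Subgroup.closure (Γ.toCoxeterSystem.simple '' J) → t' = t) :
    (run Γ T l p).1 = p.1 * specialGen Γ T t ∧
      (run Γ T l p).2.1 =
        Γ.toCoxeterSystem.simple (t : X) * p.2.1 * Γ.toCoxeterSystem.wordProd l := by
  induction l generalizing p with
  | nil => simp at ht
  | cons i l ih =>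
    have hiJ : Γ.toCoxeterSystem.simple i ∈ Subgroup.closure (Γ.toCoxeterSystem.simple '' J) :=
      Subgroup.subset_closure ⟨i, hl i (by simp), rfl⟩
    have hlJ : ∀ j ∈ l, j ∈ J := fun j hj => hl j (List.mem_cons_of_mem _ hj)
    rw [CoxeterSystem.leftInvSeq, List.nodup_cons] at hnd
    rw [CoxeterSystem.leftInvSeq, List.mem_cons] at ht
    rw [run_cons]
    by_cases hti : p.2.1⁻¹ * Γ.toCoxeterSystem.simple (t : X) * p.2.1 = Γ.toCoxeterSystem.simple i
    · have hti' : Γ.toCoxeterSystem.simple (t : X) =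
          p.2.1 * Γ.toCoxeterSystem.simple i * p.2.1⁻¹ := by
        rw [← hti]
        group
      have h1 := repStep_of_isFixed Γ T ⟨t, t.2, hti'⟩
      have h2 := stepLabel_of_eq Γ T t hti'
      obtain ⟨e1, e2⟩ := run_of_forall_notMem Γ T l (stepPerm Γ T i p) (by
        intro t' ht' hm
        rw [stepPerm_apply, h1] at hm
        obtain rfl := huniq t' ht' (CoxeterSystem.mem_closure_of_mem_leftInvSeq _ hlJ hm)
        rw [hti] at hm
        exact hnd.1 (List.mem_map.2 ⟨_, hm, by simp⟩))
      rw [e1, e2, stepPerm_apply, h1, h2, CoxeterSystem.wordProd_cons, hti']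
      simp [-CoxeterMatrix.toCoxeterSystem_simple, mul_assoc]
    · have hi : ¬ IsFixed Γ T i p.2.1 := by
        rintro ⟨t', ht', e⟩
        have e' : p.2.1⁻¹ * Γ.toCoxeterSystem.simple t' * p.2.1 = Γ.toCoxeterSystem.simple i := by
          rw [e]
          group
        obtain rfl := huniq t' ht' (e' ▸ hiJ)
        exact hti e'
      have h1 := repStep_of_not_isFixed Γ T hi
      have h2 := stepLabel_of_not_isFixed Γ T hi
      obtain ⟨r, hr, hr'⟩ := List.mem_map.1 (ht.resolve_left hti)
      obtain ⟨e1, e2⟩ := ih hlJ hnd.2.of_map (stepPerm Γ T i p) (by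
          rw [stepPerm_apply, h1]
          convert hr using 1
          rw [MulAut.conj_apply, CoxeterSystem.inv_simple] at hr'
          simp only [mul_inv_rev, CoxeterSystem.inv_simple]
          rw [show Γ.toCoxeterSystem.simple i * p.2.1⁻¹ * Γ.toCoxeterSystem.simple (t : X) *
            (p.2.1 * Γ.toCoxeterSystem.simple i) = Γ.toCoxeterSystem.simple i *
            (p.2.1⁻¹ * Γ.toCoxeterSystem.simple (t : X) * p.2.1) * Γ.toCoxeterSystem.simple i by
              group, ← hr']
          simp [-CoxeterMatrix.toCoxeterSystem_simple, mul_assoc])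
        (by
          intro t' ht' hm
          rw [stepPerm_apply, h1] at hm
          refine huniq t' ht' ?_
          have := mul_mem (mul_mem hiJ hm) hiJ
          simpa [-CoxeterMatrix.toCoxeterSystem_simple, mul_assoc] using this)
      rw [e1, e2, stepPerm_apply, h1, h2, CoxeterSystem.wordProd_cons, mul_one]
      simp only [mul_assoc, and_self]

theorem run_altWord_of_eq {i j : X} (s t : T) (n : ℕ) (p : specialSubgroup Γ T × MinimalRep Γ T)
    (hs : Γ.toCoxeterSystem.simple (s : X) = p.2.1 * Γ.toCoxeterSystem.simple i * p.2.1⁻¹)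
    (ht : Γ.toCoxeterSystem.simple (t : X) = p.2.1 * Γ.toCoxeterSystem.simple j * p.2.1⁻¹) :
    run Γ T (altWord i j n) p = (p.1 * ((altWord s t n).map (specialGen Γ T)).prod, p.2) := by
  induction n generalizing i j s t p with
  | zero => simp [altWord, run]
  | succ n ih =>
    have h1 := repStep_of_isFixed Γ T ⟨s, s.2, hs⟩
    have h2 := stepLabel_of_eq Γ T s hs
    rw [altWord, run_cons, stepPerm_apply, h1, h2,
      ih t s (p.1 * specialGen Γ T s, p.2) ht hs, altWord, List.map_cons, List.prod_cons, mul_assoc]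

theorem run_eq_of_wordProd_eq {J : Set X} {l l' : List X} (hl : ∀ i ∈ l, i ∈ J)
    (hl' : ∀ i ∈ l', i ∈ J) (hnd : (Γ.toCoxeterSystem.leftInvSeq l).Nodup)
    (hnd' : (Γ.toCoxeterSystem.leftInvSeq l').Nodup)
    (h : Γ.toCoxeterSystem.wordProd l = Γ.toCoxeterSystem.wordProd l')
    (p : specialSubgroup Γ T × MinimalRep Γ T)
    (huniq : ∀ t ∈ T, ∀ t' ∈ T,
      p.2.1⁻¹ * Γ.toCoxeterSystem.simple t * p.2.1 ∈
        Subgroup.closure (Γ.toCoxeterSystem.simple '' J) →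
      p.2.1⁻¹ * Γ.toCoxeterSystem.simple t' * p.2.1 ∈
        Subgroup.closure (Γ.toCoxeterSystem.simple '' J) → t = t') :
    run Γ T l p = run Γ T l' p := by
  have hmem : ∀ r, r ∈ Γ.toCoxeterSystem.leftInvSeq l ↔ r ∈ Γ.toCoxeterSystem.leftInvSeq l' := by
    intro r
    rw [CoxeterSystem.mem_leftInvSeq_iff_of_nodup _ hnd,
      CoxeterSystem.mem_leftInvSeq_iff_of_nodup _ hnd', h]
  by_cases ht : ∃ t ∈ T,
      p.2.1⁻¹ * Γ.toCoxeterSystem.simple t * p.2.1 ∈ Γ.toCoxeterSystem.leftInvSeq l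
  · obtain ⟨t, ht, htl⟩ := ht
    have hu : ∀ t' ∈ T, p.2.1⁻¹ * Γ.toCoxeterSystem.simple t' * p.2.1 ∈
        Subgroup.closure (Γ.toCoxeterSystem.simple '' J) → t' = t := fun t' ht' h' =>
      huniq t' ht' t ht h' (CoxeterSystem.mem_closure_of_mem_leftInvSeq _ hl htl)
    obtain ⟨e1, e2⟩ := run_of_mem Γ T l hl hnd p ⟨t, ht⟩ htl hu
    obtain ⟨e1', e2'⟩ := run_of_mem Γ T l' hl' hnd' p ⟨t, ht⟩ ((hmem _).1 htl) hu
    exact Prod.ext (e1.trans e1'.symm) (Subtype.ext (e2.trans (h ▸ e2'.symm)))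
  · push Not at ht
    obtain ⟨e1, e2⟩ := run_of_forall_notMem Γ T l p ht
    obtain ⟨e1', e2'⟩ := run_of_forall_notMem Γ T l' p fun t h1 h2 => ht t h1 ((hmem _).2 h2)
    exact Prod.ext (e1.trans e1'.symm) (Subtype.ext (e2.trans (h ▸ e2'.symm)))

theorem run_braid (i j : X) (p : specialSubgroup Γ T × MinimalRep Γ T) :
    run Γ T (altWord i j (Γ i j)) p = run Γ T (altWord j i (Γ i j)) p := by
  obtain ⟨u, hup, hu⟩ := Γ.toCoxeterSystem.exists_minimal_coset_rep
    (Subgroup.closure (Γ.toCoxeterSystem.simple '' {i, j})) p.2.1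
  by_cases hb : ∃ s ∈ T, ∃ t ∈ T,
      Γ.toCoxeterSystem.simple s = u * Γ.toCoxeterSystem.simple i * u⁻¹ ∧
      Γ.toCoxeterSystem.simple t = u * Γ.toCoxeterSystem.simple j * u⁻¹
  · obtain ⟨s, hsT, t, htT, hs, ht⟩ := hb
    have hpu : p.2.1 = u := by
      refine Γ.toCoxeterSystem.eq_minimal_coset_rep hu hup ?_
      rintro k (rfl | rfl)
      · rw [← hs]
        exact p.2.2 s hsT
      · rw [← ht]
        exact p.2.2 t htT
    rw [← hpu] at hs ht
    have hm : Γ i j = Γ s t := by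
      rw [← Γ.toCoxeterSystem.orderOf_simple_mul_simple,
        ← Γ.toCoxeterSystem.orderOf_simple_mul_simple, hs, ht,
        ← MulEquiv.orderOf_eq (MulAut.conj p.2.1)]
      simp [-CoxeterMatrix.toCoxeterSystem_simple, mul_assoc]
    rw [run_altWord_of_eq Γ T ⟨s, hsT⟩ ⟨t, htT⟩ _ p hs ht,
      run_altWord_of_eq Γ T ⟨t, htT⟩ ⟨s, hsT⟩ _ p ht hs, hm]
    exact Prod.ext (congrArg (p.1 * ·) (specialGen_braid Γ T ⟨s, hsT⟩ ⟨t, htT⟩)) rfl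
  · refine run_eq_of_wordProd_eq Γ T (J := {i, j}) (fun k hk => mem_altWord hk)
      (fun k hk => (mem_altWord hk).symm) (Γ.toCoxeterSystem.nodup_leftInvSeq_altWord i j) ?_
      (Γ.toCoxeterSystem.wordProd_altWord_comm i j) p ?_
    · rw [Γ.symmetric]
      exact Γ.toCoxeterSystem.nodup_leftInvSeq_altWord j i
    · have hconj : ∀ t ∈ T, p.2.1⁻¹ * Γ.toCoxeterSystem.simple t * p.2.1 ∈
          Subgroup.closure (Γ.toCoxeterSystem.simple '' {i, j}) →
          Γ.toCoxeterSystem.simple t = u * Γ.toCoxeterSystem.simple i * u⁻¹ ∨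
          Γ.toCoxeterSystem.simple t = u * Γ.toCoxeterSystem.simple j * u⁻¹ := by
        intro t _ h
        have h' := mul_mem (mul_mem hup h) (inv_mem hup)
        obtain ⟨k, rfl | rfl, hk⟩ := Γ.toCoxeterSystem.exists_simple_eq_conj hu (k := t) (by
          convert h' using 1
          group)
        · exact Or.inl hk
        · exact Or.inr hk
      intro t ht t' ht' h h'
      rcases hconj t ht h with e | e <;> rcases hconj t' ht' h' with e' | e'
      · exact Γ.toCoxeterSystem.simple_injective (e.trans e'.symm)
      · exact absurd ⟨t, ht, t', ht', e, e'⟩ hb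
      · exact absurd ⟨t', ht', t, ht, e', e⟩ hb
      · exact Γ.toCoxeterSystem.simple_injective (e.trans e'.symm)

end ArtinGroup

namespace ArtinGroup

variable {X : Type*} (Γ : CoxeterMatrix X) (T : Set X)

theorem unop_map_stepPerm_prod (l : List X) (p : specialSubgroup Γ T × MinimalRep Γ T) :
    (l.map fun i => MulOpposite.op (stepPerm Γ T i)).prod.unop p = run Γ T l p := by
  induction l generalizing p with
  | nil => rfl
  | cons i l ih =>
    rw [List.map_cons, List.prod_cons, run_cons, ← ih]
    rfl

/-- The right action of the Artin group on `A_T × (W_T \ W)`. -/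
noncomputable def cosetAction :
    ArtinGroup Γ →* (Equiv.Perm (specialSubgroup Γ T × MinimalRep Γ T))ᵐᵒᵖ :=
  PresentedGroup.toGroup (f := fun i => MulOpposite.op (stepPerm Γ T i)) (by
    rintro _ ⟨⟨i, j⟩, rfl⟩
    have h : ∀ l : List X, FreeGroup.lift (fun i => MulOpposite.op (stepPerm Γ T i))
        (l.map FreeGroup.of).prod = (l.map fun i => MulOpposite.op (stepPerm Γ T i)).prod := by
      intro l
      rw [map_list_prod, List.map_map]
      congr 1
    rw [Function.uncurry_apply_pair, artinRelator, map_mul, map_inv, mul_inv_eq_one, h, h]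
    refine MulOpposite.unop_injective (Equiv.ext fun p => ?_)
    rw [unop_map_stepPerm_prod, unop_map_stepPerm_prod, run_braid])

theorem cosetAction_mul (g h : ArtinGroup Γ) (p : specialSubgroup Γ T × MinimalRep Γ T) :
    (cosetAction Γ T (g * h)).unop p = (cosetAction Γ T h).unop ((cosetAction Γ T g).unop p) := by
  rw [map_mul]
  rfl

theorem cosetAction_gen (i : X) (p : specialSubgroup Γ T × MinimalRep Γ T) :
    (cosetAction Γ T (gen Γ i)).unop p = (p.1 * stepLabel Γ T i p.2, repStep Γ T i p.2) := by
  rw [cosetAction, gen, PresentedGroup.toGroup.of]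
  rfl

/-- The trivial coset. -/
def baseRep : MinimalRep Γ T := ⟨1, fun _ _ => CoxeterSystem.inversionParity_one _ _⟩

theorem cosetAction_baseRep (g : ArtinGroup Γ) (hg : g ∈ specialSubgroup Γ T)
    (c : specialSubgroup Γ T) :
    (cosetAction Γ T g).unop (c, baseRep Γ T) = (c * ⟨g, hg⟩, baseRep Γ T) := by
  induction hg using Subgroup.closure_induction generalizing c with
  | mem x hx =>
    obtain ⟨t, ht, rfl⟩ := hx
    have h : Γ.toCoxeterSystem.simple t =
        (baseRep Γ T).1 * Γ.toCoxeterSystem.simple t * (baseRep Γ T).1⁻¹ := by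
      simp [baseRep]
    rw [cosetAction_gen, repStep_of_isFixed Γ T ⟨t, ht, h⟩, stepLabel_of_eq Γ T ⟨t, ht⟩ h]
    rfl
  | one => rw [map_one]; exact Prod.ext (mul_one c).symm rfl
  | mul x y hx hy ihx ihy =>
    rw [cosetAction_mul, ihx, ihy, mul_assoc]
    rfl
  | inv x hx ih =>
    have h := ih (c * ⟨x, hx⟩⁻¹)
    rw [inv_mul_cancel_right] at h
    rw [map_inv, MulOpposite.unop_inv, Equiv.Perm.inv_eq_iff_eq, ← h]
    rfl

/-- The retraction of the Artin group onto its special subgroup `A_T`. -/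
noncomputable def retraction (g : ArtinGroup Γ) : specialSubgroup Γ T :=
  ((cosetAction Γ T g).unop (1, baseRep Γ T)).1

theorem retraction_coe (a : specialSubgroup Γ T) : retraction Γ T a = a := by
  rw [retraction, cosetAction_baseRep Γ T a a.2, one_mul]

theorem exists_retraction_mul (g : ArtinGroup Γ) {m : ArtinGroup Γ} (hm : m ∈ positiveMonoid Γ) :
    ∃ m' ∈ specialPositiveMonoid Γ T, retraction Γ T (g * m) = retraction Γ T g * m' := by
  induction hm using Submonoid.closure_induction generalizing g with
  | mem x hx =>
    obtain ⟨i, rfl⟩ := hx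
    refine ⟨_, stepLabel_mem Γ T i ((cosetAction Γ T g).unop (1, baseRep Γ T)).2, ?_⟩
    rw [retraction, cosetAction_mul, cosetAction_gen]
    rfl
  | one => exact ⟨1, one_mem _, by simp⟩
  | mul x y _ _ hx hy =>
    obtain ⟨a, ha, ea⟩ := hx g
    obtain ⟨b, hb, eb⟩ := hy (g * x)
    exact ⟨a * b, mul_mem ha hb, by rw [← mul_assoc, eb, ea, mul_assoc]⟩

theorem isSimplicialRetraction_retraction :
    IsSimplicialRetraction (cayleyInclusion Γ T) (retraction Γ T) where
  map_edge u v h := by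
    rw [monoidCayley, SimpleGraph.mulCayley_adj] at h
    rw [or_iff_not_imp_left, specialMonoidCayley, SimpleGraph.mulCayley_adj]
    refine fun hne => ⟨hne, h.2.imp (fun hm => ?_) fun hm => ?_⟩
    · obtain ⟨m, hm, e⟩ := exists_retraction_mul Γ T u hm
      rw [mul_inv_cancel_left] at e
      simpa [e] using hm
    · obtain ⟨m, hm, e⟩ := exists_retraction_mul Γ T v hm
      rw [mul_inv_cancel_left] at e
      simpa [e] using hm
  retract := retraction_coe Γ T

end ArtinGroup

namespace IsSimplicialRetraction

variable {V W : Type*} {G : SimpleGraph V} {H : SimpleGraph W} {i : H →g G} {r : V → W}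

theorem edist_le_length (hr : IsSimplicialRetraction i r) {u v : V} (p : G.Walk u v) :
    H.edist (r u) (r v) ≤ p.length := by
  induction p with
  | nil => simp
  | cons h p ih =>
    rw [SimpleGraph.Walk.length_cons, Nat.cast_add, Nat.cast_one, add_comm]
    refine SimpleGraph.edist_triangle.trans (add_le_add ?_ ih)
    rcases hr.map_edge _ _ h with h | h
    · simp [h]
    · exact (SimpleGraph.edist_eq_one_iff_adj.2 h).le

theorem edist_map (hr : IsSimplicialRetraction i r) (a b : W) :
    G.edist (i a) (i b) = H.edist a b := by
  refine le_antisymm (le_iInf fun p => ?_) (le_iInf fun p => ?_)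
  · simpa using SimpleGraph.edist_le (p.map i)
  · simpa only [hr.retract] using hr.edist_le_length p

end IsSimplicialRetraction

theorem proposition2p2 {X : Type*} [Finite X] (Γ : CoxeterMatrix X)
    (T : Set X) (hT : T.Nonempty) :
    (∃ r : ArtinGroup Γ → ArtinGroup.specialSubgroup Γ T,
      IsSimplicialRetraction (ArtinGroup.cayleyInclusion Γ T) r ∧
      ∀ g : ArtinGroup Γ, ∀ m ∈ ArtinGroup.positiveMonoid Γ,
        ∃ m' ∈ ArtinGroup.specialPositiveMonoid Γ T, r (g * m) = r g * m') ∧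
    (∀ a b : ArtinGroup.specialSubgroup Γ T,
      (ArtinGroup.monoidCayley Γ).edist
          (ArtinGroup.cayleyInclusion Γ T a) (ArtinGroup.cayleyInclusion Γ T b) =
        (ArtinGroup.specialMonoidCayley Γ T).edist a b) ∧
    (∀ (a b : ArtinGroup.specialSubgroup Γ T)
      (p : (ArtinGroup.specialMonoidCayley Γ T).Walk a b),
      p.IsGeodesic → (p.map (ArtinGroup.cayleyInclusion Γ T)).IsGeodesic) := by
  have hr := ArtinGroup.isSimplicialRetraction_retraction Γ T
  refine ⟨⟨_, hr, fun g m hm => ArtinGroup.exists_retraction_mul Γ T g hm⟩, hr.edist_map, ?_⟩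
  intro a b p hp
  rw [SimpleGraph.Walk.IsGeodesic, SimpleGraph.Walk.length_map, hr.edist_map]
  exact hp
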